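/- Conventions. A total structure is a set with finitary total operations and finitary relations; homomorphisms preserve operations and relations, isomorphisms are bijections that also reflect the relations. A substructure is a subset closed under the operations with the restricted relations (possibly empty if there are no nullary operations). Powers are structured coordinatewise. For $\mathbf X$ carrying a topology, $\mathbf X^\flat$ denotes its underlying structure, and isomorphisms of structures with topology are isomorphisms of structures that are homeomorphisms. Let $\mathbf M_1=\langle M;G_1,R_1\rangle$ be a total structure on a finite set $M$ with $G_1$ and $R_1$ finite (finite type), and let $\mathbf M_2=\langle M;G_2,R_2\rangle$ be a total structure on the same set that is compatible with $\mathbf M_1$: every $n$-ary operation in $G_2$ is a homomorphism $\mathbf M_1^n\to\mathbf M_1$ and every $n$-ary relation in $R_2$ is a substructure of $\mathbf M_1^n$. Let $\mathscr T$ be the discrete topology on $M$, and let $\mathbf M_i^{\mathscr T}$ be $\mathbf M_i$ with $\mathscr T$ added. Define the following classes. - $\mathcal A=\mathsf{ISP}(\mathbf M_1)$: isomorphic copies of non-empty substructures of powers of $\mathbf M_1$. - $\mathcal A_{\mathscr T}=\mathsf{IS}_{\mathrm c}\mathsf P(\mathbf M_1^{\mathscr T})$: isomorphic copies of non-empty topologically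 closed substructures of powers of $\mathbf M_1^{\mathscr T}$. - $\mathcal X=\mathsf{IS}^0\mathsf P^+(\mathbf M_2)$: isomorphic copies of possibly empty substructures of powers of $\mathbf M_2$ with non-empty index set. - $\mathcal X_{\mathscr T}=\mathsf{IS}^0_{\mathrm c}\mathsf P^+(\mathbf M_2^{\mathscr T})$: isomorphic copies of possibly empty topologically closed substructures of powers of $\mathbf M_2^{\mathscr T}$ with non-empty index set. Morphisms are the homomorphisms in $\mathcal A$ and $\mathcal X$, and the continuous homomorphisms in $\mathcal A_{\mathscr T}$ and $\mathcal X_{\mathscr T}$. The contravariant hom-functors $\mathrm D\colon\mathcal A\to\mathcal X_{\mathscr T}$, $\mathrm E\colon\mathcal X_{\mathscr T}\to\mathcal A$, $\mathrm F\colon\mathcal A_{\mathscr T}\to\mathcal X$, $\mathrm G\colon\mathcal X\to\mathcal A_{\mathscr T}$ are given on objects by $$\mathrm D(\mathbf A)=\mathcal A(\mathbf A,\mathbf M_1)\le(\mathbf M_2^{\mathscr T})^A,\quad \mathrm E(\mathbf X)=\mathcal X_{\mathscr T}(\mathbf X,\mathbf M_2^{\mathscr T})\le\mathbf M_1^X,$$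 $$\mathrm F(\mathbf A)=\mathcal A_{\mathscr T}(\mathbf A,\mathbf M_1^{\mathscr T})\le\mathbf M_2^A,\quad \mathrm G(\mathbf X)=\mathcal X(\mathbf X,\mathbf M_2)\le(\mathbf M_1^{\mathscr T})^X,$$ and on morphisms by composition. For $\mathbf A\in\mathcal A$ the natural extension $n_{\mathcal A}(\mathbf A)$ is the topologically closed substructure of $(\mathbf M_1^{\mathscr T})^{\mathcal A(\mathbf A,\mathbf M_1)}$ generated by the evaluations $x\mapsto x(a)$, $a\in A$. For $\mathbf X\in\mathcal X$ the natural extension $n_{\mathcal X}(\mathbf X)\le(\mathbf M_2^{\mathscr T})^{\mathcal X(\mathbf X,\mathbf M_2)}$ is defined likewise. On a morphism $u\colon\mathbf A\to\mathbf B$ of $\mathcal A$ the functor $n_{\mathcal A}$ is given by $f\mapsto\bigl(y\mapsto f(y\circ u)\bigr)$, and similarly for $n_{\mathcal X}$. Assume that $\mathbf M_2^{\mathscr T}$ yields a full duality between $\mathcal A$ and $\mathcal X_{\mathscr T}$, that is, the evaluation maps $\mathbf A\to\mathrm{ED}(\mathbf A)$ and $\mathbf X\to\mathrm{DE}(\mathbf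 X)$ are isomorphisms for all $\mathbf A\in\mathcal A$ and all $\mathbf X\in\mathcal X_{\mathscr T}$. Then $\mathbf M_2$ yields a full duality between $\mathcal A_{\mathscr T}$ and $\mathcal X$, that is, the evaluation maps $\mathbf A\to\mathrm{GF}(\mathbf A)$ and $\mathbf X\to\mathrm{FG}(\mathbf X)$ are isomorphisms for all $\mathbf A\in\mathcal A_{\mathscr T}$ and all $\mathbf X\in\mathcal X$. Moreover: (1) $n_{\mathcal A}(\mathbf A)=\mathrm G(\mathrm D(\mathbf A)^\flat)$ for all $\mathbf A\in\mathcal A$ and $n_{\mathcal X}(\mathbf X)=\mathrm D(\mathrm G(\mathbf X)^\flat)$ for all $\mathbf X\in\mathcal X$, as structures with topology, and the corresponding functors also agree on morphisms; (2) for all $\mathbf A\in\mathcal A$, $n_{\mathcal A}(\mathbf A)$ consists of all maps $\mathcal A(\mathbf A,\mathbf M_1)\to M$ that preserve the operations and relations of $\mathbf M_2$; (3) for all $\mathbf X\in\mathcal X$, $n_{\mathcal X}(\mathbf X)$ consists of all maps $\mathcal X(\mathbf X,\mathbf M_2)\to M$ that preserve the operations and relations of $\mathbf M_1$. -/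

import Mathlib

open FirstOrder FirstOrder.Language FirstOrder.Language.Structure

/-! Total structures are first-order structures in the sense of Mathlib: a language has operation
symbols and relation symbols of every finite arity (including `0`), homomorphisms `→[L]` preserve
operations and relations, and isomorphisms `≃[L]` moreover reflect relations. A substructure is a
subset closed under the operations, with the restricted relations; it may be empty. A structure with
topology is a type carrying both a structure and a topology. -/

universe u u₁ v₁ u₂ v₂

namespace PairedDuality

/-- The power `M ^ I` of a structure, structured coordinatewise. (Powers of spaces carry the product
topology, and substructures carry the subspace topology; both are instances already.) -/
instance powerStructure {L : FirstOrder.Language.{u₁, v₁}} {I M : Type*} [L.Structure M] :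
    L.Structure (I → M) where
  funMap g x := fun i => funMap g (fun k => x k i)
  RelMap r x := ∀ i, RelMap r (fun k => x k i)

section Classes

variable (L : FirstOrder.Language.{u₁, v₁}) (M : Type u) [L.Structure M] (A : Type u) [L.Structure A]

/-- `A ∈ ISP(M)`: `A` is isomorphic to a non-empty substructure of a power of `M`
(the empty-indexed power is allowed). -/
def InISP : Prop :=
  ∃ (I : Type u) (S : L.Substructure (I → M)), (S : Set (I → M)).Nonempty ∧ Nonempty (A ≃[L] S)

/-- `A ∈ IS⁰P⁺(M)`: `A` is isomorphic to a possibly empty substructure of a power of `M`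
with non-empty index set. -/
def InIS0PPlus : Prop :=
  ∃ (I : Type u) (S : L.Substructure (I → M)), Nonempty I ∧ Nonempty (A ≃[L] S)

variable [TopologicalSpace M] [TopologicalSpace A]

/-- `A ∈ IS_cP(M)` for structures with topology: `A` is isomorphic, by an isomorphism of structures
that is a homeomorphism, to a non-empty topologically closed substructure of a power of `M`
(the empty-indexed power is allowed). -/
def InIScP : Prop :=
  ∃ (I : Type u) (S : L.Substructure (I → M)), (S : Set (I → M)).Nonempty ∧
    IsClosed (S : Set (I → M)) ∧ ∃ φ : A ≃[L] S, IsHomeomorph φ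

/-- `A ∈ IS⁰_cP⁺(M)` for structures with topology: as `InIScP`, but the closed substructure may be
empty, and the index set of the power may not. -/
def InIS0cPPlus : Prop :=
  ∃ (I : Type u) (S : L.Substructure (I → M)), Nonempty I ∧
    IsClosed (S : Set (I → M)) ∧ ∃ φ : A ≃[L] S, IsHomeomorph φ

end Classes

/-- The `L'`-structure on `M` is compatible with the `L`-structure on `M`: each `L'`-operation is an
`L`-homomorphism `M ^ n → M` and each `L'`-relation is an `L`-substructure of `M ^ n`. -/
def Compatible (L : FirstOrder.Language.{u₁, v₁}) (L' : FirstOrder.Language.{u₂, v₂}) (M : Type u)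
    [L.Structure M] [L'.Structure M] : Prop :=
  (∀ (n : ℕ) (g : L'.Functions n), ∃ φ : (Fin n → M) →[L] M, ∀ x, φ x = funMap g x) ∧
  (∀ (n : ℕ) (r : L'.Relations n), ∃ S : L.Substructure (Fin n → M), ∀ x, x ∈ S ↔ RelMap r x)

section Functors

variable {L : FirstOrder.Language.{u₁, v₁}} {L' : FirstOrder.Language.{u₂, v₂}} {M : Type u}
  [L.Structure M] [L'.Structure M]

theorem Compatible.comm (h : Compatible L L' M) {n m : ℕ} (g : L'.Functions n)
    (f : L.Functions m) (x : Fin m → Fin n → M) :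
    funMap g (fun i => funMap f (fun j => x j i)) = funMap f (fun j => funMap g (x j)) := by
  obtain ⟨φ, hφ⟩ := h.1 n g
  have h1 := φ.map_fun f x
  have h2 : (φ ∘ x) = fun j => funMap g (x j) := funext fun j => hφ (x j)
  rw [h2, hφ] at h1
  exact h1

theorem Compatible.op_rel (h : Compatible L L' M) {n m : ℕ} (g : L'.Functions n)
    (r : L.Relations m) (x : Fin m → Fin n → M) (hx : ∀ i, RelMap r (fun j => x j i)) :
    RelMap r (fun j => funMap g (x j)) := by
  obtain ⟨φ, hφ⟩ := h.1 n g
  have := φ.map_rel r x hx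
  simpa [Function.comp_def, hφ] using this

theorem Compatible.rel_op (h : Compatible L L' M) {n m : ℕ} (r : L'.Relations n)
    (f : L.Functions m) (x : Fin m → Fin n → M) (hx : ∀ j, RelMap r (x j)) :
    RelMap r (fun i => funMap f (fun j => x j i)) := by
  obtain ⟨S, hS⟩ := h.2 n r
  exact (hS _).1 (S.fun_mem f x (fun j => (hS _).2 (hx j)))

/-- Compatibility is symmetric. -/
theorem Compatible.symm (h : Compatible L L' M) : Compatible L' L M := by
  refine ⟨fun n g => ⟨⟨fun x => funMap g x, ?_, ?_⟩, fun x => rfl⟩, fun n r =>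
    ⟨⟨{x | RelMap r x}, ?_⟩, fun x => Iff.rfl⟩⟩
  · intro m f x
    exact (h.comm f g (fun i j => x j i)).symm
  · intro m r x hx
    exact h.rel_op r g (fun i j => x j i) hx
  · intro m f x hx
    exact h.op_rel f r (fun i j => x j i) hx

variable (L M) in
/-- The hom-set of all `L`-homomorphisms `A → M`, as a set of maps. -/
def homs (A : Type u) [L.Structure A] : Set (A → M) :=
  {f | ∃ φ : A →[L] M, ∀ a, φ a = f a}

/-- The dual of an `L`-structure `A`: the hom-set of all `L`-homomorphisms `A → M`, as an
`L'`-substructure of `M ^ A`. It carries the subspace topology of `M ^ A`. -/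
def dual (h : Compatible L L' M) (A : Type u) [L.Structure A] : L'.Substructure (A → M) where
  carrier := homs L M A
  fun_mem := by
    intro n g x hx
    choose φ hφ using hx
    refine ⟨⟨fun a => funMap g (fun i => φ i a), ?_, ?_⟩, ?_⟩
    · intro m f y
      simp only [Hom.map_fun]
      exact h.comm g f (fun j i => φ i (y j))
    · intro m r y hy
      exact h.op_rel g r (fun j i => φ i (y j)) (fun i => (φ i).map_rel r y hy)
    · intro a
      change funMap g (fun i => φ i a) = funMap g (fun i => x i a)
      simp only [hφ]

/-- The dual of an `L`-structure `A` with topology: the set of all continuous `L`-homomorphisms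
`A → M` as an `L'`-substructure of `M ^ A`. -/
def contDual [TopologicalSpace M] [DiscreteTopology M] (h : Compatible L L' M) (A : Type u)
    [L.Structure A] [TopologicalSpace A] : L'.Substructure (A → M) where
  carrier := {f | f ∈ homs L M A ∧ Continuous f}
  fun_mem := by
    intro n g x hx
    refine ⟨(dual h A).fun_mem g x (fun i => (hx i).1), ?_⟩
    have h1 : Continuous (fun a => (fun i => x i a : Fin n → M)) :=
      continuous_pi (fun i => (hx i).2)
    exact (continuous_of_discreteTopology (f := fun y : Fin n → M => funMap g y)).comp h1

/-- The action of the (topology-free) hom-functor on a homomorphism `w : A → B`: the map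
`D(B) → D(A)` given by `y ↦ y ∘ w`. -/
def dualMap (h : Compatible L L' M) {A B : Type u} [L.Structure A] [L.Structure B]
    (w : A →[L] B) : dual h B →[L'] dual h A where
  toFun y := ⟨fun a => y.1 (w a), by
    obtain ⟨φ, hφ⟩ := y.2
    exact ⟨φ.comp w, fun a => hφ (w a)⟩⟩
  map_fun' _ _ := rfl
  map_rel' _ _ hx := fun a => hx (w a)

/-- The evaluation map from an `L`-structure `A` into its double dual `a ↦ (x ↦ x a)`. The first
dual is formed without a topology on `A`; it is a structure with topology, and the second dual
consists of its continuous homomorphisms into `M`. -/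
def evalCont [TopologicalSpace M] [DiscreteTopology M] (h : Compatible L L' M) (A : Type u)
    [L.Structure A] (a : A) : contDual h.symm (dual h A) :=
  ⟨fun x => x.1 a,
    ⟨⟨fun x => x.1 a, fun _ _ => rfl, fun _ _ hx => hx a⟩, fun _ => rfl⟩,
    (continuous_apply a).comp continuous_subtype_val⟩

/-- The evaluation map from an `L`-structure `A` with topology into its double dual
`a ↦ (x ↦ x a)`. The first dual consists of the continuous homomorphisms and is taken without
topology; the second dual consists of all homomorphisms, and it is a structure with topology. -/
def evalDisc [TopologicalSpace M] [DiscreteTopology M] (h : Compatible L L' M) (A : Type u)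
    [L.Structure A] [TopologicalSpace A] (a : A) : dual h.symm (contDual h A) :=
  ⟨fun x => x.1 a, ⟨fun x => x.1 a, fun _ _ => rfl, fun _ _ hx => hx a⟩, fun _ => rfl⟩

/-- With `M₁` the `L`-structure and `M₂` the `L'`-structure on `M`, `𝒜 = ISP(M₁)` and
`𝒳_𝒯 = IS⁰_cP⁺(M₂^𝒯)`: the alter ego `M₂^𝒯` yields a full duality between `𝒜` and `𝒳_𝒯`, that is,
the evaluation maps `A → E(D(A))` and `X → D(E(X))` are isomorphisms for all `A ∈ 𝒜`
(as structures) and all `X ∈ 𝒳_𝒯` (as structures with topology). -/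
def AlterEgoFullDuality [TopologicalSpace M] [DiscreteTopology M] (h : Compatible L L' M) : Prop :=
  (∀ (A : Type u) [L.Structure A], InISP L M A →
    ∃ φ : A ≃[L] contDual h.symm (dual h A), ∀ a, φ a = evalCont h A a) ∧
  (∀ (X : Type u) [L'.Structure X] [TopologicalSpace X], InIS0cPPlus L' M X →
    ∃ φ : X ≃[L'] dual h (contDual h.symm X), IsHomeomorph φ ∧ ∀ x, φ x = evalDisc h.symm X x)

/-- With `M₁` the `L`-structure and `M₂` the `L'`-structure on `M`, `𝒜_𝒯 = IS_cP(M₁^𝒯)` and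
`𝒳 = IS⁰P⁺(M₂)`: the structure `M₂` yields a full duality between `𝒜_𝒯` and `𝒳`, that is,
the evaluation maps `A → G(F(A))` and `X → F(G(X))` are isomorphisms for all `A ∈ 𝒜_𝒯`
(as structures with topology) and all `X ∈ 𝒳` (as structures). -/
def SwappedFullDuality [TopologicalSpace M] [DiscreteTopology M] (h : Compatible L L' M) : Prop :=
  (∀ (A : Type u) [L.Structure A] [TopologicalSpace A], InIScP L M A →
    ∃ φ : A ≃[L] dual h.symm (contDual h A), IsHomeomorph φ ∧ ∀ a, φ a = evalDisc h A a) ∧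
  (∀ (X : Type u) [L'.Structure X], InIS0PPlus L' M X →
    ∃ φ : X ≃[L'] contDual h (dual h.symm X), ∀ x, φ x = evalCont h.symm X x)

end Functors

section NaturalExtension

variable (L : FirstOrder.Language.{u₁, v₁}) (M : Type u) [L.Structure M] [TopologicalSpace M]

/-- The evaluation map `a ↦ (x ↦ x a)` of `A` into the power of `M` indexed by all homomorphisms
`x : A → M`. -/
def evalPower (A : Type u) [L.Structure A] (a : A) : homs L M A → M := fun x => x.1 a

/-- The natural extension of `A` relative to `M`: the topologically closed substructure generated
by the image of the evaluation map in the power of `M` indexed by all homomorphisms `A → M`. -/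
def natExt (A : Type u) [L.Structure A] : L.Substructure (homs L M A → M) :=
  sInf {S | Set.range (evalPower L M A) ⊆ (S : Set (homs L M A → M)) ∧
    IsClosed (S : Set (homs L M A → M))}

variable {L M}

/-- The continuous homomorphism `f ↦ (y ↦ f (y ∘ w))` between powers of `M` induced by a
homomorphism `w : A → B`. -/
def powerMap {A B : Type u} [L.Structure A] [L.Structure B] (w : A →[L] B) :
    (homs L M A → M) →[L] (homs L M B → M) where
  toFun f := fun y => f ⟨fun a => y.1 (w a), by
    obtain ⟨φ, hφ⟩ := y.2
    exact ⟨φ.comp w, fun a => hφ (w a)⟩⟩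
  map_fun' _ _ := rfl
  map_rel' _ _ hx := fun y => hx ⟨fun a => y.1 (w a), by
    obtain ⟨φ, hφ⟩ := y.2
    exact ⟨φ.comp w, fun a => hφ (w a)⟩⟩

theorem powerMap_mem {A B : Type u} [L.Structure A] [L.Structure B] (w : A →[L] B)
    {f : homs L M A → M} (hf : f ∈ natExt L M A) : powerMap w f ∈ natExt L M B := by
  refine Substructure.mem_sInf.2 fun S hS => ?_
  refine Substructure.mem_sInf.1 hf (S.comap (powerMap w)) ⟨?_, ?_⟩
  · rintro _ ⟨a, rfl⟩
    exact hS.1 ⟨w a, rfl⟩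
  · have hw : Continuous (powerMap (M := M) w) := continuous_pi fun y => continuous_apply _
    exact hS.2.preimage hw

/-- The action of the natural extension on homomorphisms: the restriction of `powerMap`. -/
def natExtMap {A B : Type u} [L.Structure A] [L.Structure B] (w : A →[L] B) :
    natExt L M A →[L] natExt L M B where
  toFun f := ⟨powerMap w f.1, powerMap_mem w f.2⟩
  map_fun' _ _ := rfl
  map_rel' _ _ hx := fun _ => hx _

/-- A map `b : Hom_L(A, M) → M` preserves the `L'`-structure on `M`: it preserves the graph of every
`L'`-operation and every `L'`-relation, read pointwise on the hom-set. -/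
def PreservesStructure (L' : FirstOrder.Language.{u₂, v₂}) [L'.Structure M] {A : Type u} [L.Structure A]
    (b : homs L M A → M) : Prop :=
  (∀ (n : ℕ) (g : L'.Functions n) (x : Fin n → homs L M A) (y : homs L M A),
    (∀ a, y.1 a = funMap g (fun i => (x i).1 a)) → b y = funMap g (fun i => b (x i))) ∧
  (∀ (n : ℕ) (r : L'.Relations n) (x : Fin n → homs L M A),
    (∀ a, RelMap r (fun i => (x i).1 a)) → RelMap r (fun i => b (x i)))

end NaturalExtension

end PairedDuality

open PairedDuality

/-!
The given duality says that a continuous homomorphism from a hom-set into `M` is an evaluation. The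
swapped duality makes the same claim with the topology moved to the other side, and the two claims
coincide on finite structures, where the topology is discrete. So the work is a reduction to finite
structures, by compactness, and finite type is what makes it possible.

The engine is `eventually_preserves`: if a closed substructure of `M ^ I` is a decreasing
intersection of closed sets, then a continuous map that preserves the structure on the intersection
preserves it already on one of these sets. It is applied to two presentations of an inverse limit.

* A closed substructure of `M ^ I` is the limit of its projections to finite sets of coordinates,
  so its continuous homomorphisms into `M` factor through finite projections
  (`exists_factor_restrict`). A homomorphism on the continuous dual is then determined, and seen to
  be an evaluation, by the duality for these projections (`evalDisc_surjective`).
* `X` in `IS⁰P⁺(M)` is the union of its finitely generated substructures, which are finite, so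
  its hom-set is the limit of theirs. The maps of this limit system need not be surjective, yet a
  continuous homomorphism on the limit factors through one of its terms (`exists_factor_closure`),
  where it is an evaluation (`swapped_iso_of_discrete`).

For the natural extension, let `N` be the topological closure of `A` in the power of `M` indexed by
the hom-set of `A`. A continuous homomorphism `N → M` is determined by its restriction to the dense
subset `A`, so the continuous dual of `N` is the hom-set of `A`. By the duality for `N`, every
structure-preserving map on that hom-set is evaluation at a point of `N`, that is, an element of
`N` (`dual_le_closureEval`). This argument is symmetric in the two structures: one side uses the
swapped duality, the other the given one.
-/

namespace PairedDuality

/-! ### Functions on powers of a finite discrete space -/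

section Compactness

variable {I M : Type*} [TopologicalSpace M] [DiscreteTopology M]

theorem continuous_of_dependsOn_finset {f : (I → M) → M} (F : Finset I)
    (hf : ∀ x y : I → M, (∀ i ∈ F, x i = y i) → f x = f y) : Continuous f := by
  refine continuous_iff_continuousAt.2 fun x => ?_
  have hU : {y : I → M | ∀ i ∈ F, y i = x i} ∈ nhds x := by
    have : {y : I → M | ∀ i ∈ F, y i = x i} = (F : Set I).pi fun i => {x i} := by
      ext y; simp [Set.mem_pi]
    rw [this]
    exact set_pi_mem_nhds F.finite_toSet fun i _ => (isOpen_discrete _).mem_nhds rfl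
  refine Filter.Tendsto.congr' ?_ (tendsto_const_nhds (x := f x))
  filter_upwards [hU] with y hy
  exact (hf y x hy).symm

theorem mem_of_forall_finset {I M : Type*} [TopologicalSpace M] {S : Set (I → M)} (hS : IsClosed S) {x : I → M}
    (hx : ∀ F : Finset I, ∃ y ∈ S, ∀ i ∈ F, y i = x i) : x ∈ S := by
  refine hS.closure_subset ((mem_closure_iff_nhds).2 fun U hU => ?_)
  rw [nhds_pi, Filter.mem_pi'] at hU
  obtain ⟨F, t, ht, hU⟩ := hU
  obtain ⟨y, hyS, hy⟩ := hx F
  exact ⟨y, hU fun i hi => by rw [hy i hi]; exact mem_of_mem_nhds (ht i), hyS⟩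

/-- A continuous function on a closed subset of a power of a finite discrete space extends to a
function on the whole power that depends on finitely many coordinates only. -/
theorem exists_extension_dependsOn_finset [Finite M] {S : Set (I → M)} (hS : IsClosed S) {f : S → M}
    (hf : Continuous f) (m : M) :
    ∃ (F : Finset I) (g : (I → M) → M),
      (∀ x y : I → M, (∀ i ∈ F, x i = y i) → g x = g y) ∧ ∀ s : S, g s = f s := by
  classical
  have : CompactSpace S := isCompact_iff_compactSpace.1 hS.isCompact
  have hK : IsCompact {p : S × S | f p.1 ≠ f p.2} :=
    (isClosed_discrete {q : M × M | q.1 ≠ q.2}).preimage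
      ((hf.comp continuous_fst).prodMk (hf.comp continuous_snd)) |>.isCompact
  -- The pairs separated by `f` are covered by the conditions of differing in some coordinate.
  obtain ⟨F, hF⟩ := hK.elim_finite_subfamily_closed
    (fun i : I => {p : S × S | p.1.1 i = p.2.1 i})
    (fun i => isClosed_eq ((continuous_apply i).comp (continuous_subtype_val.comp continuous_fst))
      ((continuous_apply i).comp (continuous_subtype_val.comp continuous_snd)))
    (by
      refine Set.eq_empty_of_forall_notMem fun p hp => hp.1 ?_
      rw [Subtype.ext (funext fun i => Set.mem_iInter.1 hp.2 i) (a1 := p.1) (a2 := p.2)])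
  have hF' : ∀ s t : S, (∀ i ∈ F, s.1 i = t.1 i) → f s = f t := fun s t hst => by
    by_contra hne
    exact Set.notMem_empty (s, t) (hF ▸ ⟨hne, Set.mem_iInter₂.2 hst⟩)
  refine ⟨F, fun x => if hx : ∃ s : S, ∀ i ∈ F, s.1 i = x i then f hx.choose else m, ?_, ?_⟩
  · intro x y hxy
    have : (fun s : S => ∀ i ∈ F, s.1 i = x i) = fun s : S => ∀ i ∈ F, s.1 i = y i := by
      funext s
      exact propext (forall₂_congr fun i hi => by rw [hxy i hi])
    simp only [this]
  · intro s
    have hx : ∃ t : S, ∀ i ∈ F, t.1 i = s.1 i := ⟨s, fun _ _ => rfl⟩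
    exact (dif_pos hx).trans (hF' _ _ hx.choose_spec)

end Compactness

/-! ### Inverse limits and finite type -/

/-- Let a closed substructure of `M ^ I` be approximated from above by a decreasing family of closed
sets `C F`, and let `T F` be an increasing family of sets of coordinates that exhausts `I`. If `L`
has finitely many symbols and a continuous `f : M ^ I → M` is a homomorphism on `⋂ F, C F`, then it
preserves the structure already on `C F`, with the relations of `M ^ I` read only at the
coordinates in `T F`, for all large `F`. This is where the finite type is needed: every symbol
costs one application of compactness. -/
theorem eventually_preserves {L : FirstOrder.Language.{u₁, v₁}} [Finite L.Symbols] {I M : Type*}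
    [Finite M] [TopologicalSpace M] [DiscreteTopology M] [L.Structure M]
    {C : Finset I → Set (I → M)} (hCa : Antitone C) (hCc : ∀ F, IsClosed (C F))
    {T : Finset I → Set I} (hTm : Monotone T) (hT : ∀ i, ∃ F, i ∈ T F)
    {f : (I → M) → M} (hf : Continuous f)
    (hfun : ∀ (n : ℕ) (g : L.Functions n) (x : Fin n → I → M), (∀ k F, x k ∈ C F) →
      f (funMap g x) = funMap g fun k => f (x k))
    (hrel : ∀ (n : ℕ) (r : L.Relations n) (x : Fin n → I → M), (∀ k F, x k ∈ C F) →
      (∀ i, RelMap r fun k => x k i) → RelMap r fun k => f (x k)) :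
    ∀ᶠ F in Filter.atTop,
      (∀ (n : ℕ) (g : L.Functions n) (x : Fin n → I → M), (∀ k, x k ∈ C F) →
        f (funMap g x) = funMap g fun k => f (x k)) ∧
      (∀ (n : ℕ) (r : L.Relations n) (x : Fin n → I → M), (∀ k, x k ∈ C F) →
        (∀ i ∈ T F, RelMap r fun k => x k i) → RelMap r fun k => f (x k)) := by
  have hfs : Finite (Σ n, L.Functions n) := Finite.of_injective (β := L.Symbols) _ Sum.inl_injective
  have hrs : Finite (Σ n, L.Relations n) := Finite.of_injective (β := L.Symbols) _ Sum.inr_injective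
  have key : ∀ {n : ℕ} (V : Finset I → Set (Fin n → I → M)), Antitone V → (∀ F, IsClosed (V F)) →
      ∀ U : Set (Fin n → I → M), IsOpen U → (⋂ F, V F) ⊆ U → ∀ᶠ F in Filter.atTop, V F ⊆ U := by
    intro n V hVa hVc U hU hVU
    obtain ⟨F, hF⟩ := exists_subset_nhds_of_isCompact' hVa.directed_ge
      (fun F => (hVc F).isCompact) hVc fun x hx => hU.mem_nhds (hVU hx)
    filter_upwards [Filter.eventually_ge_atTop F] with F' hF'
    exact (hVa hF').trans hF
  have hCpi : ∀ n F, IsClosed {x : Fin n → I → M | ∀ k, x k ∈ C F} := fun n F => by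
    simp only [Set.ofPred_forall]
    exact isClosed_iInter fun k => (hCc F).preimage (continuous_apply k)
  have hfx : ∀ n, Continuous fun (x : Fin n → I → M) (k : Fin n) => f (x k) := fun n =>
    continuous_pi fun k => hf.comp (continuous_apply k)
  have h1 : ∀ g : Σ n, L.Functions n, ∀ᶠ F in Filter.atTop, ∀ x : Fin g.1 → I → M,
      (∀ k, x k ∈ C F) → f (funMap g.2 x) = funMap g.2 fun k => f (x k) := by
    rintro ⟨n, g⟩
    refine key (fun F => {x | ∀ k, x k ∈ C F}) (fun F F' hF x hx k => hCa hF (hx k)) (hCpi n)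
      {x | f (funMap g x) = funMap g fun k => f (x k)} ?_ ?_
    · have hg : Continuous fun x : Fin n → I → M => (funMap g x : I → M) :=
        continuous_pi fun i => (continuous_of_discreteTopology
          (f := fun y : Fin n → M => funMap g y)).comp
          (continuous_pi fun k => (continuous_apply i).comp (continuous_apply k))
      exact (isOpen_discrete {q : M × M | q.1 = q.2}).preimage ((hf.comp hg).prodMk
        ((continuous_of_discreteTopology (f := fun y : Fin n → M => funMap g y)).comp (hfx n)))
    · intro x hx
      exact hfun n g x fun k F => Set.mem_iInter.1 hx F k
  have h2 : ∀ r : Σ n, L.Relations n, ∀ᶠ F in Filter.atTop, ∀ x : Fin r.1 → I → M,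
      ((∀ k, x k ∈ C F) ∧ ∀ i ∈ T F, RelMap r.2 fun k => x k i) →
        RelMap r.2 fun k => f (x k) := by
    rintro ⟨n, r⟩
    refine key (fun F => {x | (∀ k, x k ∈ C F) ∧ ∀ i ∈ T F, RelMap r fun k => x k i})
      (fun F F' hF x hx => ⟨fun k => hCa hF (hx.1 k), fun i hi => hx.2 i (hTm hF hi)⟩) (fun F => ?_)
      {x | RelMap r fun k => f (x k)} ?_ ?_
    · refine (hCpi n F).inter (?_ : IsClosed {x : Fin n → I → M | ∀ i ∈ T F, RelMap r fun k => x k i})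
      simp only [Set.ofPred_forall]
      exact isClosed_iInter fun i => isClosed_iInter fun _ =>
        (isClosed_discrete {y : Fin n → M | RelMap r y}).preimage
          (continuous_pi fun k => (continuous_apply i).comp (continuous_apply k))
    · exact (isOpen_discrete {y : Fin n → M | RelMap r y}).preimage (hfx n)
    · intro x hx
      rw [Set.mem_iInter] at hx
      refine hrel n r x (fun k F => (hx F).1 k) fun i => ?_
      obtain ⟨F, hF⟩ := hT i
      exact (hx F).2 i hF
  filter_upwards [Filter.eventually_all.2 h1, Filter.eventually_all.2 h2] with F hF1 hF2
  exact ⟨fun n g => hF1 ⟨n, g⟩, fun n r x hx hr => hF2 ⟨n, r⟩ x ⟨hx, hr⟩⟩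

/-! ### Hom-sets, and finitely generated substructures of powers -/

section Homs

variable {L : FirstOrder.Language.{u₁, v₁}} {M : Type u} [L.Structure M]

theorem mem_homs_iff {A : Type u} [L.Structure A] {f : A → M} :
    f ∈ homs L M A ↔
      (∀ (n : ℕ) (g : L.Functions n) (x : Fin n → A), f (funMap g x) = funMap g (f ∘ x)) ∧
      (∀ (n : ℕ) (r : L.Relations n) (x : Fin n → A), RelMap r x → RelMap r (f ∘ x)) := by
  constructor
  · rintro ⟨φ, hφ⟩
    obtain rfl : ⇑φ = f := funext hφ
    exact ⟨fun n g x => φ.map_fun g x, fun n r x => φ.map_rel r x⟩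
  · rintro ⟨h1, h2⟩
    exact ⟨⟨f, fun {n} => h1 n, fun {n} => h2 n⟩, fun _ => rfl⟩

theorem comp_mem_homs {A B : Type u} [L.Structure A] [L.Structure B] {f : B → M}
    (hf : f ∈ homs L M B) (w : A →[L] B) : (fun a => f (w a)) ∈ homs L M A := by
  obtain ⟨φ, hφ⟩ := hf
  exact ⟨φ.comp w, fun a => hφ (w a)⟩

theorem coord_mem_homs {X : Type u} [L.Structure X] {J : Type u} {S : L.Substructure (J → M)}
    (φ : X ≃[L] S) (j : J) : (fun p => (φ p).1 j) ∈ homs L M X :=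
  ⟨⟨fun a => (φ a).1 j, fun g x => by rw [φ.map_fun]; rfl,
    fun r x hr => ((φ.map_rel r x).2 hr) j⟩, fun _ => rfl⟩

theorem isClosed_homs [TopologicalSpace M] [DiscreteTopology M] (A : Type u) [L.Structure A] :
    IsClosed (homs L M A) := by
  have hc : ∀ (n : ℕ) (x : Fin n → A), Continuous fun f : A → M => f ∘ x := fun n x =>
    continuous_pi fun k => continuous_apply (x k)
  have : homs L M A =
      (⋂ (n : ℕ) (g : L.Functions n) (x : Fin n → A), {f | f (funMap g x) = funMap g (f ∘ x)}) ∩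
      ⋂ (n : ℕ) (r : L.Relations n) (x : Fin n → A) (_ : RelMap r x), {f | RelMap r (f ∘ x)} := by
    ext f
    simp only [mem_homs_iff, Set.mem_inter_iff, Set.mem_iInter, Set.mem_ofPred_eq]
  rw [this]
  refine .inter ?_ ?_
  · exact isClosed_iInter fun n => isClosed_iInter fun g => isClosed_iInter fun x =>
      isClosed_eq (continuous_apply _) (continuous_of_discreteTopology.comp (hc n x))
  · exact isClosed_iInter fun n => isClosed_iInter fun r => isClosed_iInter fun x =>
      isClosed_iInter fun _ => (isClosed_discrete {y : Fin n → M | RelMap r y}).preimage (hc n x)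

/-- The hom-set of a structure is determined by its finitely generated substructures. -/
theorem mem_homs_of_forall_closure {A : Type u} [L.Structure A] {f : A → M}
    (hf : ∀ F : Finset A, (fun p : Substructure.closure L (F : Set A) => f p) ∈
      homs L M (Substructure.closure L (F : Set A))) : f ∈ homs L M A := by
  classical
  have hx : ∀ {n : ℕ} (x : Fin n → A) (k : Fin n),
      x k ∈ Substructure.closure L ((Finset.univ.image x : Finset A) : Set A) := fun x k =>
    Substructure.subset_closure (by simp)
  refine mem_homs_iff.2 ⟨fun n g x => ?_, fun n r x hr => ?_⟩
  · exact (mem_homs_iff.1 (hf (Finset.univ.image x))).1 n g fun k => ⟨x k, hx x k⟩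
  · exact (mem_homs_iff.1 (hf (Finset.univ.image x))).2 n r (fun k => ⟨x k, hx x k⟩) hr

/-- Powers of a finite structure are locally finite: the elements generated by a finite set `F` are
the values of term functions, and these are maps `M ^ F → M`. -/
theorem finite_closure_power [Finite M] {J : Type*} (F : Finset (J → M)) :
    (Substructure.closure L (F : Set (J → M)) : Set (J → M)).Finite := by
  let W : L.Substructure (J → M) :=
    { carrier := Set.range fun (t : (F → M) → M) (j : J) => t fun x => x.1 j
      fun_mem := by
        intro n g x hx
        choose t ht using hx
        refine ⟨fun y => funMap g fun k => t k y, ?_⟩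
        funext j
        change _ = funMap g fun k => x k j
        simp only [← ht] }
  have hW : Substructure.closure L (F : Set (J → M)) ≤ W :=
    Substructure.closure_le.2 fun x hx => ⟨fun y => y ⟨x, hx⟩, rfl⟩
  exact (Set.finite_range _).subset hW

theorem finite_closure_of_equiv [Finite M] {X : Type u} [L.Structure X] {J : Type u}
    {S : L.Substructure (J → M)} (φ : X ≃[L] S) (F : Finset X) :
    Finite (Substructure.closure L (F : Set X)) := by
  classical
  let ι : X →[L] (J → M) := S.subtype.toHom.comp φ.toHom
  have hι : Function.Injective ι := fun a b hab => φ.injective (Subtype.ext hab)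
  have h1 := finite_closure_power (L := L) (F.image ι)
  rw [Finset.coe_image, ← Substructure.map_closure] at h1
  exact (Set.Finite.of_finite_image h1 hι.injOn).to_subtype

/-- A finite substructure of a member of `IS⁰P⁺(M)`, with the discrete topology, is in
`IS⁰_cP⁺(M^𝒯)`. -/
theorem inIS0cPPlus_of_finite [TopologicalSpace M] [DiscreteTopology M] {X : Type u} [L.Structure X]
    (hX : InIS0PPlus L M X) (Y : L.Substructure X) [Finite Y] [TopologicalSpace Y]
    [DiscreteTopology Y] : InIS0cPPlus L M Y := by
  obtain ⟨J, S, hJ, ⟨φ⟩⟩ := hX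
  let ι : X ↪[L] (J → M) := S.subtype.comp φ.toEmbedding
  have hfin : Finite (Y.map ι.toHom) := ((Set.toFinite (Y : Set X)).image ι).to_subtype
  refine ⟨J, Y.map ι.toHom, hJ, (Set.toFinite _).isClosed, ι.substructureEquivMap Y, ?_⟩
  exact isHomeomorph_iff_continuous_isClosedMap_bijective.2 ⟨continuous_of_discreteTopology,
    fun _ _ => (Set.toFinite _).isClosed, (ι.substructureEquivMap Y).bijective⟩

end Homs


section Duality

variable {L : FirstOrder.Language.{u₁, v₁}} {L' : FirstOrder.Language.{u₂, v₂}} {M : Type u}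
  [L.Structure M] [L'.Structure M] [TopologicalSpace M] [DiscreteTopology M]

/-! ### The swapped duality on structures with topology -/

/-- A continuous homomorphism from a closed substructure `S` of `M ^ I` factors, as a homomorphism,
through the projection of `S` to finitely many coordinates. -/
theorem exists_factor_restrict [Finite M] [Finite L.Symbols] {I : Type u} {S : L.Substructure (I → M)}
    (hS : IsClosed (S : Set (I → M))) {f : S → M} (hf : Continuous f) (hom : f ∈ homs L M S) (m : M) :
    ∃ (F : Finset I) (ρ : (I → M) →[L] (F → M)) (β : S.map ρ → M), (∀ x i, ρ x i = x i) ∧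
      β ∈ homs L M (S.map ρ) ∧ ∀ s : S, f s = β ⟨ρ s, s, s.2, rfl⟩ := by
  classical
  obtain ⟨F₀, g, hg, hgf⟩ := exists_extension_dependsOn_finset hS hf m
  let C : Finset I → Set (I → M) := fun F => {x | ∃ s ∈ S, ∀ i ∈ F, s i = x i}
  have hCc : ∀ F, IsClosed (C F) := fun F => by
    have hr : Continuous fun (x : I → M) (i : F) => x i := continuous_pi fun i => continuous_apply _
    convert (isClosed_discrete {y : F → M | ∃ s ∈ S, ∀ i : F, s i = y i}).preimage hr using 1
    ext x
    simp [C]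
  have hCS : ∀ x : I → M, (∀ F, x ∈ C F) → x ∈ S := fun x hx => mem_of_forall_finset hS hx
  have hom' := mem_homs_iff.1 hom
  have hev := eventually_preserves (L := L) (C := C) (T := fun F => (F : Set I))
    (fun F F' hF x ⟨s, hs, hx⟩ => ⟨s, hs, fun i hi => hx i (hF hi)⟩) hCc
    (fun F F' hF => Finset.coe_subset.2 hF) (fun i => ⟨{i}, by simp⟩)
    (continuous_of_dependsOn_finset F₀ hg)
    (by
      intro n o x hx
      have := hom'.1 n o fun k => ⟨x k, hCS _ (hx k)⟩
      rw [← hgf] at this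
      refine this.trans (congrArg _ (funext fun k => (hgf _).symm)))
    (by
      intro n r x hx hr
      have := hom'.2 n r (fun k => ⟨x k, hCS _ (hx k)⟩) hr
      convert this using 1
      exact funext fun k => hgf ⟨x k, hCS _ (hx k)⟩)
  obtain ⟨F, ⟨hF1, hF2⟩, hF⟩ := (hev.and (Filter.eventually_ge_atTop F₀)).exists
  let ρ : (I → M) →[L] (F → M) :=
    { toFun := fun x i => x i
      map_fun' := fun _ _ => rfl
      map_rel' := fun _ _ h i => h i }
  let e : (F → M) → I → M := fun y i => if h : i ∈ F then y ⟨i, h⟩ else m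
  have he : ∀ (y : F → M) (i : F), e y i = y i := fun y i => dif_pos i.2
  have hCe : ∀ y : S.map ρ, e y.1 ∈ C F := by
    rintro ⟨_, s, hs, rfl⟩
    exact ⟨s, hs, fun i hi => (he (ρ s) ⟨i, hi⟩).symm⟩
  refine ⟨F, ρ, fun y => g (e y.1), fun _ _ => rfl, mem_homs_iff.2 ⟨fun n o x => ?_, fun n r x hr => ?_⟩,
    fun s => ?_⟩
  · refine (hg _ _ fun i hi => ?_).trans (hF1 n o (fun k => e (x k).1) fun k => hCe (x k))
    refine (he _ ⟨i, hF hi⟩).trans ?_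
    change funMap o (fun k => (x k).1 ⟨i, hF hi⟩) = funMap o fun k => e (x k).1 i
    exact congrArg _ (funext fun k => (he _ ⟨i, hF hi⟩).symm)
  · refine hF2 n r (fun k => e (x k).1) (fun k => hCe (x k)) fun i hi => ?_
    have := hr ⟨i, hi⟩
    convert this using 1
    exact funext fun k => he _ ⟨i, hi⟩
  · rw [← hgf]
    exact hg _ _ fun i hi => (he (ρ s) ⟨i, hF hi⟩).symm

theorem coord_mem_contDual (hc : Compatible L L' M) {A : Type u} [L.Structure A]
    [TopologicalSpace A] {I : Type u} {S : L.Substructure (I → M)} {φ : A ≃[L] S}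
    (hφ : Continuous φ) (i : I) : (fun a => (φ a).1 i) ∈ contDual hc A :=
  ⟨coord_mem_homs φ i, (continuous_apply i).comp (continuous_subtype_val.comp hφ)⟩

/-- If `γ` is a homomorphism on the continuous dual of `A ≤ M ^ I`, then the point of `M ^ I` whose
coordinates are the values of `γ` at the coordinate projections lies in `A`, and `γ` is evaluation
at it. Both claims concern finitely many coordinates at a time, where they follow from the duality
for the finite projections of `A`. -/
theorem evalDisc_surjective [Finite M] [Finite L.Symbols] (hc : Compatible L L' M)
    (hfull : ∀ (A : Type u) [L.Structure A], InISP L M A → Function.Surjective (evalCont hc A))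
    {A : Type u} [L.Structure A] [TopologicalSpace A] (hA : InIScP L M A) :
    Function.Surjective (evalDisc hc A) := by
  classical
  obtain ⟨I, S, hne, hS, φ, hφ⟩ := hA
  have hφs : Continuous φ.symm :=
    (hφ.homeomorph φ).symm.continuous.congr fun s => by
      rw [Homeomorph.symm_apply_eq]; exact (φ.apply_symm_apply s).symm
  intro γ
  have hγ := mem_homs_iff.1 γ.2
  let c : I → contDual hc A := fun i => ⟨_, coord_mem_contDual hc hφ.continuous i⟩
  let b : I → M := fun i => γ.1 (c i)
  obtain ⟨s₀, hs₀⟩ := hne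
  -- On the finite projection `S.map ρ` the map `γ` is evaluation at some `ρ s`, by duality for `S.map ρ`.
  have key : ∀ (F : Finset I) (ρ : (I → M) →[L] (F → M)), (∀ x i, ρ x i = x i) →
      ∃ s : S, (∀ i : F, s.1 i = b i) ∧ ∀ (β : S.map ρ → M) (hβ : β ∈ homs L M (S.map ρ))
        (x : contDual hc A), (∀ t : S, x.1 (φ.symm t) = β ⟨ρ t, t, t.2, rfl⟩) →
          γ.1 x = β ⟨ρ s, s, s.2, rfl⟩ := by
    intro F ρ hρ
    let π : A → S.map ρ := fun a => ⟨ρ (φ a), (φ a).1, (φ a).2, rfl⟩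
    let πh : A →[L] S.map ρ :=
      { toFun := π
        map_fun' := fun o x => Subtype.ext (by
          change ρ (φ (funMap o x)) = _
          rw [φ.map_fun]
          exact ρ.map_fun o fun k => ((φ (x k)).1))
        map_rel' := fun r x hr => ρ.map_rel r _ ((φ.map_rel r x).2 hr) }
    have hπ : Continuous π := by
      refine Continuous.subtype_mk (continuous_pi fun i => ?_) _
      simp only [hρ]
      exact (continuous_apply _).comp (continuous_subtype_val.comp hφ.continuous)
    have hρc : ∀ β : S.map ρ → M, Continuous β := fun β => continuous_of_discreteTopology
    let d : dual hc (S.map ρ) → contDual hc A := fun z =>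
      ⟨fun a => z.1 (π a), comp_mem_homs z.2 πh, (hρc z.1).comp hπ⟩
    let γF : contDual hc.symm (dual hc (S.map ρ)) :=
      ⟨fun z => γ.1 (d z), mem_homs_iff.2 ⟨fun n o x => hγ.1 n o (d ∘ x),
        fun n r x hr => hγ.2 n r (d ∘ x) fun a => hr (π a)⟩, continuous_of_discreteTopology⟩
    obtain ⟨⟨_, s, hs, rfl⟩, hsγ⟩ := hfull (S.map ρ)
      ⟨F, S.map ρ, ⟨ρ s₀, s₀, hs₀, rfl⟩, ⟨Language.Equiv.refl L _⟩⟩ γF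
    have hev : ∀ z : dual hc (S.map ρ), γ.1 (d z) = z.1 ⟨ρ s, s, hs, rfl⟩ := fun z =>
      (congrFun (congrArg Subtype.val hsγ) z).symm
    refine ⟨⟨s, hs⟩, fun i => ?_, fun β hβ x hx => ?_⟩
    · let z : dual hc (S.map ρ) := ⟨fun y => y.1 i,
        ⟨⟨fun y => y.1 i, fun _ _ => rfl, fun _ _ hr => hr i⟩, fun _ => rfl⟩⟩
      have : d z = c i := Subtype.ext (funext fun a => hρ _ i)
      exact (hρ s i).symm.trans ((hev z).symm.trans (congrArg γ.1 this))
    · have : d ⟨β, hβ⟩ = x := Subtype.ext (funext fun a => by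
        have := hx (φ a)
        rw [φ.symm_apply_apply] at this
        exact this.symm)
      rw [← this]
      exact hev ⟨β, hβ⟩
  have hb : b ∈ S := by
    refine mem_of_forall_finset hS fun F => ?_
    obtain ⟨s, hs, -⟩ := key F
      { toFun := fun x i => x i, map_fun' := fun _ _ => rfl, map_rel' := fun _ _ h i => h i }
      fun _ _ => rfl
    exact ⟨s.1, s.2, fun i hi => hs ⟨i, hi⟩⟩
  refine ⟨φ.symm ⟨b, hb⟩, Subtype.ext (funext fun x => ?_)⟩
  change x.1 (φ.symm ⟨b, hb⟩) = γ.1 x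
  obtain ⟨F, ρ, β, hρ, hβ, hf⟩ := exists_factor_restrict hS (f := fun s => x.1 (φ.symm s))
    (x.2.2.comp hφs) (comp_mem_homs x.2.1 φ.symm.toHom) (x.1 (φ.symm ⟨s₀, hs₀⟩))
  obtain ⟨s, hs, h⟩ := key F ρ hρ
  rw [h β hβ x hf]
  refine (hf ⟨b, hb⟩).trans (congrArg β (Subtype.ext (funext fun i => ?_)))
  exact (hρ b i).trans ((hs i).symm.trans (hρ s.1 i).symm)

theorem swapped_iso_of_top [Finite M] [Finite L.Symbols] (hc : Compatible L L' M)
    (hfull : ∀ (A : Type u) [L.Structure A], InISP L M A → Function.Surjective (evalCont hc A))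
    {A : Type u} [L.Structure A] [TopologicalSpace A] (hA : InIScP L M A) :
    ∃ φ : A ≃[L] dual hc.symm (contDual hc A), IsHomeomorph φ ∧ ∀ a, φ a = evalDisc hc A a := by
  have hsurj := evalDisc_surjective hc hfull hA
  obtain ⟨I, S, -, hS, φ, hφ⟩ := hA
  have hcoord := coord_mem_contDual hc hφ.continuous
  have hinj : Function.Injective (evalDisc hc A) := fun a a' h =>
    φ.injective (Subtype.ext (funext fun i =>
      congrFun (congrArg Subtype.val h) ⟨_, hcoord i⟩))
  refine ⟨⟨Equiv.ofBijective _ ⟨hinj, hsurj⟩, fun o x => ?_, fun r x => ⟨fun h => ?_, fun h => ?_⟩⟩,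
    ?_, fun a => rfl⟩
  · exact Subtype.ext (funext fun x' => (mem_homs_iff.1 x'.2.1).1 _ o x)
  · exact (φ.map_rel r x).1 fun i => h ⟨_, hcoord i⟩
  · exact fun x' => (mem_homs_iff.1 x'.2.1).2 _ r x h
  · have : CompactSpace S := isCompact_iff_compactSpace.1 hS.isCompact
    have : CompactSpace A := (hφ.homeomorph φ).symm.compactSpace
    exact isHomeomorph_iff_continuous_bijective.2
      ⟨Continuous.subtype_mk (continuous_pi fun x => x.2.2) _, hinj, hsurj⟩

/-! ### The swapped duality on structures without topology -/

/-- A continuous homomorphism `α` on the hom-set of `X` factors, as a homomorphism, through the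
restriction of homomorphisms to some finitely generated substructure of `X`. -/
theorem exists_factor_closure [Finite M] [Finite L.Symbols] (hc : Compatible L L' M) {X : Type u}
    [L'.Structure X] {α : dual hc.symm X → M} (hα : α ∈ contDual hc (dual hc.symm X)) (m : M) :
    ∃ (F : Finset X) (β : dual hc.symm (Substructure.closure L' (F : Set X)) → M),
      β ∈ homs L M (dual hc.symm (Substructure.closure L' (F : Set X))) ∧
      ∀ x : dual hc.symm X,
        α x = β (dualMap hc.symm (Substructure.closure L' (F : Set X)).subtype.toHom x) := by
  classical
  obtain ⟨F₀, g, hg, hgα⟩ := exists_extension_dependsOn_finset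
    (S := (dual hc.symm X : Set (X → M))) (isClosed_homs X) hα.2 m
  let T : Finset X → L'.Substructure X := fun F => Substructure.closure L' (F : Set X)
  have hTm : Monotone T := fun F F' hF => Substructure.closure_mono (Finset.coe_subset.2 hF)
  let C : Finset X → Set (X → M) := fun F => {x | (fun p : T F => x p) ∈ homs L' M (T F)}
  have hCc : ∀ F, IsClosed (C F) := fun F =>
    (isClosed_homs (T F)).preimage (f := fun (x : X → M) (p : T F) => x p)
      (continuous_pi fun p => continuous_apply _)
  have hCS : ∀ x : X → M, (∀ F, x ∈ C F) → x ∈ dual hc.symm X :=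
    fun x hx => mem_homs_of_forall_closure hx
  have hα' := mem_homs_iff.1 hα.1
  have hev := eventually_preserves (L := L) (C := C) (T := fun F => (T F : Set X))
    (fun F F' hF x hx => comp_mem_homs hx (Substructure.inclusion (hTm hF)).toHom) hCc
    (fun F F' hF => hTm hF) (fun i => ⟨{i}, Substructure.subset_closure (by simp)⟩)
    (continuous_of_dependsOn_finset F₀ hg)
    (by
      intro n o x hx
      have := hα'.1 n o fun k => ⟨x k, hCS _ (hx k)⟩
      rw [← hgα] at this
      refine this.trans (congrArg _ (funext fun k => (hgα _).symm)))
    (by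
      intro n r x hx hr
      have := hα'.2 n r (fun k => ⟨x k, hCS _ (hx k)⟩) hr
      convert this using 1
      exact funext fun k => hgα ⟨x k, hCS _ (hx k)⟩)
  obtain ⟨F, ⟨hF1, hF2⟩, hF⟩ := (hev.and (Filter.eventually_ge_atTop F₀)).exists
  have hFT : ∀ i ∈ F₀, i ∈ T F := fun i hi => Substructure.subset_closure (hF hi)
  let e : (T F → M) → X → M := fun y p => if h : p ∈ T F then y ⟨p, h⟩ else m
  have he : ∀ (y : T F → M) (p : T F), e y p = y p := fun y p => dif_pos p.2
  have hCe : ∀ y : dual hc.symm (T F), e y.1 ∈ C F := fun y => by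
    change (fun p : T F => e y.1 p) ∈ homs L' M (T F)
    rw [show (fun p : T F => e y.1 p) = y.1 from funext (he y.1)]
    exact y.2
  refine ⟨F, fun y => g (e y.1), mem_homs_iff.2 ⟨fun n o x => ?_, fun n r x hr => ?_⟩, fun x => ?_⟩
  · refine (hg _ _ fun i hi => ?_).trans (hF1 n o (fun k => e (x k).1) fun k => hCe (x k))
    refine (he _ ⟨i, hFT i hi⟩).trans ?_
    change funMap o (fun k => (x k).1 ⟨i, hFT i hi⟩) = funMap o fun k => e (x k).1 i
    exact congrArg _ (funext fun k => (he _ ⟨i, hFT i hi⟩).symm)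
  · refine hF2 n r (fun k => e (x k).1) (fun k => hCe (x k)) fun i hi => ?_
    have := hr ⟨i, hi⟩
    convert this using 1
    exact funext fun k => he _ ⟨i, hi⟩
  · rw [← hgα]
    exact hg _ _ fun i hi => (he (fun p => x.1 p) ⟨i, hFT i hi⟩).symm

/-- A continuous homomorphism on the hom-set of `X` comes from the hom-set of a finite substructure
of `X`. There it is an evaluation, by the duality for finite structures, whose topology is discrete. -/
theorem swapped_iso_of_discrete [Finite M] [Finite L.Symbols] (hc : Compatible L L' M)
    (hfull : ∀ (X : Type u) [L'.Structure X] [TopologicalSpace X], InIS0cPPlus L' M X →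
      Function.Surjective (evalDisc hc.symm X))
    {X : Type u} [L'.Structure X] (hX : InIS0PPlus L' M X) :
    ∃ φ : X ≃[L'] contDual hc (dual hc.symm X), ∀ x, φ x = evalCont hc.symm X x := by
  obtain ⟨J, S, hJ, ⟨φ⟩⟩ := id hX
  have hsurj : Function.Surjective (evalCont hc.symm X) := by
    intro α
    -- The index set `J` is non-empty, so `X` has a coordinate homomorphism.
    let x₀ : dual hc.symm X := ⟨_, coord_mem_homs φ hJ.some⟩
    obtain ⟨F, β, hβ, hαβ⟩ := exists_factor_closure hc α.2 (α.1 x₀)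
    have := finite_closure_of_equiv φ F
    let : TopologicalSpace (Substructure.closure L' (F : Set X)) := ⊥
    have : DiscreteTopology (Substructure.closure L' (F : Set X)) := ⟨rfl⟩
    let i : contDual hc.symm (Substructure.closure L' (F : Set X)) →
        dual hc.symm (Substructure.closure L' (F : Set X)) := fun z => ⟨z.1, z.2.1⟩
    obtain ⟨p, hp⟩ := hfull _ (inIS0cPPlus_of_finite hX (Substructure.closure L' (F : Set X)))
      ⟨fun z => β (i z), comp_mem_homs hβ ⟨i, fun _ _ => rfl, fun _ _ h => h⟩⟩
    refine ⟨p.1, Subtype.ext (funext fun x => ?_)⟩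
    rw [hαβ x]
    exact congrFun (congrArg Subtype.val hp) ⟨fun q => x.1 q,
      comp_mem_homs x.2 (Substructure.closure L' (F : Set X)).subtype.toHom,
      continuous_of_discreteTopology⟩
  have hinj : Function.Injective (evalCont hc.symm X) := fun p q h =>
    φ.injective (Subtype.ext (funext fun j =>
      congrFun (congrArg Subtype.val h) ⟨_, coord_mem_homs φ j⟩))
  refine ⟨⟨Equiv.ofBijective _ ⟨hinj, hsurj⟩, fun o x => ?_, fun r x => ⟨fun h => ?_, fun h => ?_⟩⟩,
    fun a => rfl⟩
  · exact Subtype.ext (funext fun x' => (mem_homs_iff.1 x'.2).1 _ o x)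
  · exact (φ.map_rel r x).1 fun j => h ⟨_, coord_mem_homs φ j⟩
  · exact fun x' => (mem_homs_iff.1 x'.2).2 _ r x h

/-! ### Natural extensions -/

/-- The topological closure of the image of `A` in `M ^ homs L M A`; it is a substructure since the
operations of `M` are continuous. -/
def closureEval (L : FirstOrder.Language.{u₁, v₁}) (M : Type u) [L.Structure M]
    [TopologicalSpace M] [DiscreteTopology M] (A : Type u) [L.Structure A] :
    L.Substructure (homs L M A → M) where
  carrier := closure (Set.range (evalPower L M A))
  fun_mem := by
    intro n o x hx
    have ho : Continuous fun x : Fin n → homs L M A → M => (funMap o x : homs L M A → M) :=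
      continuous_pi fun i => (continuous_of_discreteTopology
        (f := fun y : Fin n → M => funMap o y)).comp
        (continuous_pi fun k => (continuous_apply i).comp (continuous_apply k))
    have hx' : x ∈ closure (Set.univ.pi fun _ : Fin n => Set.range (evalPower L M A)) := by
      rw [closure_pi_set]
      exact fun k _ => hx k
    refine map_mem_closure ho hx' fun y hy => ?_
    choose a ha using fun k => hy k trivial
    refine ⟨funMap o a, funext fun z => ?_⟩
    refine ((mem_homs_iff.1 z.2).1 n o a).trans (congrArg _ (funext fun k => ?_))
    exact congrFun (ha k) z

theorem natExt_le_dual (hc : Compatible L L' M) (A : Type u) [L.Structure A] :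
    (natExt L M A : L.Substructure (dual hc A → M)) ≤ dual hc.symm (dual hc A) := by
  refine sInf_le ⟨?_, isClosed_homs (dual hc A)⟩
  rintro _ ⟨a, rfl⟩
  exact (evalCont hc A a).2.1

/-- If the closure `N` of `A` in `M ^ homs L M A` is its own second dual, then every homomorphism
`dual hc A → M` is in `N`: restriction to the dense subset `A` identifies the continuous dual of `N`
with `dual hc A`. -/
theorem dual_le_closureEval (hc : Compatible L L' M) (A : Type u) [L.Structure A]
    (hN : Function.Surjective (evalDisc hc (closureEval L M A))) :
    dual hc.symm (dual hc A) ≤ (closureEval L M A : L.Substructure (dual hc A → M)) := by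
  intro b hb
  have hb' := mem_homs_iff.1 hb
  let N := closureEval L M A
  let e : A → N := fun a => ⟨evalPower L M A a, subset_closure ⟨a, rfl⟩⟩
  have heh : ∀ y ∈ homs L M N, (fun a => y (e a)) ∈ homs L M A := by
    intro y hy
    refine comp_mem_homs hy ⟨e, fun o a => ?_, fun r a hr z => ?_⟩
    · exact Subtype.ext (funext fun z => (mem_homs_iff.1 z.2).1 _ o a)
    · exact (mem_homs_iff.1 z.2).2 _ r a hr
  have hdense : DenseRange e := by
    refine Subtype.dense_iff.2 fun x hx => ?_
    rw [← Set.range_comp]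
    exact hx
  let ρ : contDual hc N → dual hc A := fun y => ⟨fun a => y.1 (e a), heh y.1 y.2.1⟩
  obtain ⟨n, hn⟩ := hN ⟨fun y => b (ρ y), mem_homs_iff.2
    ⟨fun k o y => hb'.1 k o (ρ ∘ y), fun k r y hr => hb'.2 k r (ρ ∘ y) fun a => hr (e a)⟩⟩
  have hbn : b = n.1 := by
    funext x
    let y : contDual hc N := ⟨fun s => s.1 x,
      ⟨⟨fun s => s.1 x, fun _ _ => rfl, fun _ _ h => h x⟩, fun _ => rfl⟩,
      (continuous_apply _).comp continuous_subtype_val⟩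
    exact (congrFun (congrArg Subtype.val hn) y).symm
  exact hbn ▸ n.2

theorem natExt_eq_dual (hc : Compatible L L' M) (A : Type u) [L.Structure A]
    (hN : Function.Surjective (evalDisc hc (closureEval L M A))) :
    (natExt L M A : L.Substructure (dual hc A → M)) = dual hc.symm (dual hc A) :=
  le_antisymm (natExt_le_dual hc A) ((dual_le_closureEval hc A hN).trans
    (le_sInf fun _ hS => closure_minimal hS.1 hS.2))

end Duality

section

variable {L : FirstOrder.Language.{u₁, v₁}} {L' : FirstOrder.Language.{u₂, v₂}} {M : Type u}
  [L.Structure M] [L'.Structure M]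

theorem mem_dual_iff_preservesStructure (hc : Compatible L L' M) (A : Type u) [L.Structure A]
    (b : homs L M A → M) : b ∈ dual hc.symm (dual hc A) ↔ PreservesStructure L' b := by
  refine mem_homs_iff.trans (and_congr ⟨fun h n g x y hy => ?_, fun h n g x => ?_⟩ Iff.rfl)
  · have : y = (funMap g (fun i => (x i : dual hc A)) : dual hc A) := Subtype.ext (funext hy)
    exact this ▸ h n g x
  · exact h n g x _ fun _ => rfl

end

end PairedDuality

theorem corollary6p2 (L₁ : FirstOrder.Language.{u₁, v₁}) (L₂ : FirstOrder.Language.{u₂, v₂})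
    (M : Type u) [Finite M] [TopologicalSpace M] [DiscreteTopology M]
    [L₁.Structure M] [L₂.Structure M] [Finite L₁.Symbols]
    (hc : Compatible L₁ L₂ M) (hfull : AlterEgoFullDuality hc) :
    SwappedFullDuality hc ∧
    -- the two squares commute on objects, as structures with topology
    (∀ (A : Type u) [L₁.Structure A], InISP L₁ M A →
      (natExt L₁ M A : L₁.Substructure (dual hc A → M)) = dual hc.symm (dual hc A)) ∧
    (∀ (X : Type u) [L₂.Structure X], InIS0PPlus L₂ M X →
      (natExt L₂ M X : L₂.Substructure (dual hc.symm X → M)) = dual hc (dual hc.symm X)) ∧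
    -- the two squares commute on morphisms
    (∀ (A B : Type u) [L₁.Structure A] [L₁.Structure B], InISP L₁ M A → InISP L₁ M B →
      ∀ (w : A →[L₁] B) (b : natExt L₁ M A) (c : dual hc.symm (dual hc A)), b.1 = c.1 →
        (natExtMap w b).1 = (dualMap hc.symm (dualMap hc w) c).1) ∧
    (∀ (X Y : Type u) [L₂.Structure X] [L₂.Structure Y], InIS0PPlus L₂ M X → InIS0PPlus L₂ M Y →
      ∀ (w : X →[L₂] Y) (b : natExt L₂ M X) (c : dual hc (dual hc.symm X)), b.1 = c.1 →
        (natExtMap w b).1 = (dualMap hc (dualMap hc.symm w) c).1) ∧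
    -- the elements of the natural extensions
    (∀ (A : Type u) [L₁.Structure A], InISP L₁ M A →
      ∀ b : homs L₁ M A → M, b ∈ natExt L₁ M A ↔ PreservesStructure L₂ b) ∧
    (∀ (X : Type u) [L₂.Structure X], InIS0PPlus L₂ M X →
      ∀ b : homs L₂ M X → M, b ∈ natExt L₂ M X ↔ PreservesStructure L₁ b) := by
  have hA : ∀ (A : Type u) [L₁.Structure A], InISP L₁ M A →
      Function.Surjective (evalCont hc A) := fun A _ h => by
    obtain ⟨φ, hφ⟩ := hfull.1 A h
    exact (funext hφ : ⇑φ = _) ▸ φ.surjective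
  have hX : ∀ (X : Type u) [L₂.Structure X] [TopologicalSpace X], InIS0cPPlus L₂ M X →
      Function.Surjective (evalDisc hc.symm X) := fun X _ _ h => by
    obtain ⟨φ, -, hφ⟩ := hfull.2 X h
    exact (funext hφ : ⇑φ = _) ▸ φ.surjective
  have hnA : ∀ (A : Type u) [L₁.Structure A], InISP L₁ M A →
      (natExt L₁ M A : L₁.Substructure (dual hc A → M)) = dual hc.symm (dual hc A) := by
    rintro A _ ⟨I, S, ⟨s, hs⟩, ⟨φ⟩⟩
    exact natExt_eq_dual hc A (evalDisc_surjective hc hA ⟨homs L₁ M A, closureEval L₁ M A,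
      ⟨_, subset_closure ⟨φ.symm ⟨s, hs⟩, rfl⟩⟩, isClosed_closure, Language.Equiv.refl L₁ _, .id⟩)
  have hnX : ∀ (X : Type u) [L₂.Structure X], InIS0PPlus L₂ M X →
      (natExt L₂ M X : L₂.Substructure (dual hc.symm X → M)) = dual hc (dual hc.symm X) := by
    rintro X _ ⟨J, S, ⟨j⟩, ⟨φ⟩⟩
    exact natExt_eq_dual hc.symm X (hX _ ⟨homs L₂ M X, closureEval L₂ M X,
      ⟨_, coord_mem_homs φ j⟩, isClosed_closure, Language.Equiv.refl L₂ _, .id⟩)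
  refine ⟨⟨fun A _ _ h => swapped_iso_of_top hc hA h, fun X _ h => swapped_iso_of_discrete hc hX h⟩,
    hnA, hnX, ?_, ?_, fun A _ h b => ?_, fun X _ h b => ?_⟩
  · rintro A B _ _ - - w b c hbc
    exact congrArg (powerMap w) hbc
  · rintro X Y _ _ - - w b c hbc
    exact congrArg (powerMap w) hbc
  · rw [← mem_dual_iff_preservesStructure hc]
    exact SetLike.ext_iff.1 (hnA A h) b
  · rw [← mem_dual_iff_preservesStructure hc.symm]
    exact SetLike.ext_iff.1 (hnX X h) b
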